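/- Let $X$ be a complex Banach space and let $\mathcal B(X)$ be the algebra of bounded linear operators on $X$. An operator is quasi-nilpotent if its spectral radius is $0$. An operator $T\in\mathcal B(X)$ is called left generalized Drazin invertible (respectively right generalized Drazin invertible, generalized Drazin invertible) if there are closed $T$-invariant subspaces $X_1,X_2$ of $X$ with $X=X_1\oplus X_2$ such that $T|_{X_1}$ has a left inverse in $\mathcal B(X_1)$ (respectively has a right inverse in $\mathcal B(X_1)$, is invertible in $\mathcal B(X_1)$) and $T|_{X_2}$ is quasi-nilpotent; the subspaces $X_1$ and $X_2$ may be $\{0\}$. Let $\sigma_{lgD}(T)$ (respectively $\sigma_{rgD}(T)$, $\sigma_{gD}(T)$) be the set of all $\lambda\in\mathbb C$ such that $T-\lambda I$ is not left generalized Drazin invertible (respectively not right generalized Drazin invertible, not generalized Drazin invertible). Let $T,F\in\mathcal B(X)$ satisfy $TF=FT$, and suppose that $F^n$ has finite rank for some $n\in\mathbb N$. Then $$\sigma_{lgD}(T)=\sigma_{lgD}(T+F),\qquad \sigma_{rgD}(T)=\sigma_{rgD}(T+F)\qquad\text{and}\qquad \sigma_{gD}(T)=\sigma_{gD}(T+F).$$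 -/

import Mathlib

namespace GenDrazin

variable {X : Type*} [NormedAddCommGroup X] [NormedSpace ℂ X]

/-- `X = X₁ ⊕ X₂` with `X₁`, `X₂` closed subspaces that are both invariant under `T`, so that
`T = T₁ ⊕ T₂` with `Tᵢ` the restriction of `T` to `Xᵢ`. -/
structure Reduces (T : X →L[ℂ] X) (X₁ X₂ : Submodule ℂ X) : Prop where
  isClosed_left : IsClosed (X₁ : Set X)
  isClosed_right : IsClosed (X₂ : Set X)
  isCompl : IsCompl X₁ X₂
  left_invariant : ∀ x ∈ X₁, T x ∈ X₁
  right_invariant : ∀ x ∈ X₂, T x ∈ X₂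

/-- A bounded operator is quasi-nilpotent if its spectrum contains no nonzero number
(the spectrum is `{0}`, or is empty on the zero space). -/
def IsQuasiNilpotent (T : X →L[ℂ] X) : Prop :=
  spectralRadius ℂ T = 0

/-- `T = T₁ ⊕ T₂` with `T₁` left invertible (with a bounded left inverse) and `T₂`
quasi-nilpotent. -/
def IsLeftGenDrazin (T : X →L[ℂ] X) : Prop :=
  ∃ (X₁ X₂ : Submodule ℂ X) (h : Reduces T X₁ X₂),
    (T.restrict h.left_invariant).HasLeftInverse ∧
      IsQuasiNilpotent (T.restrict h.right_invariant)

/-- `T = T₁ ⊕ T₂` with `T₁` right invertible (with a bounded right inverse) and `T₂`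
quasi-nilpotent. -/
def IsRightGenDrazin (T : X →L[ℂ] X) : Prop :=
  ∃ (X₁ X₂ : Submodule ℂ X) (h : Reduces T X₁ X₂),
    (T.restrict h.left_invariant).HasRightInverse ∧
      IsQuasiNilpotent (T.restrict h.right_invariant)

/-- `T = T₁ ⊕ T₂` with `T₁` invertible and `T₂` quasi-nilpotent. -/
def IsGenDrazin (T : X →L[ℂ] X) : Prop :=
  ∃ (X₁ X₂ : Submodule ℂ X) (h : Reduces T X₁ X₂),
    IsUnit (T.restrict h.left_invariant) ∧
      IsQuasiNilpotent (T.restrict h.right_invariant)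

/-- The left generalized Drazin spectrum. -/
def leftGenDrazinSpectrum (T : X →L[ℂ] X) : Set ℂ :=
  {z : ℂ | ¬ IsLeftGenDrazin (T - z • ContinuousLinearMap.id ℂ X)}

/-- The right generalized Drazin spectrum. -/
def rightGenDrazinSpectrum (T : X →L[ℂ] X) : Set ℂ :=
  {z : ℂ | ¬ IsRightGenDrazin (T - z • ContinuousLinearMap.id ℂ X)}

/-- The generalized Drazin spectrum. -/
def genDrazinSpectrum (T : X →L[ℂ] X) : Set ℂ :=
  {z : ℂ | ¬ IsGenDrazin (T - z • ContinuousLinearMap.id ℂ X)}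

end GenDrazin

namespace GenDrazin

/-! ### One-sided inverses and commuting nilpotents. -/

section Ring

variable {A : Type*} [Ring A]

/-! The problem moves to the Banach algebra of operators: a reducing decomposition is a pair of
complementary idempotents `p`, `q` commuting with `T`, with `T * p` quasi-nilpotent and `l * T * q =
q`. Right invertibility is the same condition in the opposite algebra, and the two-sided notion is
the conjunction of the one-sided ones.

As `F` is algebraic, it has a spectral idempotent `e` at zero, with `F * e` nilpotent and `1 - e` of
finite rank. `T` is split over `e`, the nilpotent `F * e` is added there, and the algebraic element
`(T + F) * (1 - e)` is split afresh and put back.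

The crux is `mul_mul_eq_zero_of_commute`: whatever commutes with `T` has zero `q`-`p` corner. The
other corner may survive, so `T + F` is only block triangular on `e`; a Sylvester equation, solved
by a series, makes it block diagonal (`isLeftDrazinOn_of_triangular`). -/

theorem exists_left_inverse_add_of_isNilpotent {l u f : A} (hl : l * u = 1) (hc : Commute u f)
    (hf : IsNilpotent f) : ∃ m, m * (u + f) = 1 := by
  obtain ⟨n, hn⟩ := hf
  have hpow : ∀ k : ℕ, l ^ k * u ^ k = 1 := by
    intro k
    induction k with
    | zero => simp
    | succ k ih => rw [pow_succ, pow_succ', mul_assoc, ← mul_assoc l, hl, one_mul, ih]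
  -- The sum times `u + f` telescopes to `u ^ n - (-f) ^ n = u ^ n`, which `l ^ n` cancels; `l` need
  -- not commute with `f`.
  refine ⟨l ^ n * ∑ i ∈ Finset.range n, u ^ i * (-f) ^ (n - 1 - i), ?_⟩
  have h := (hc.neg_right).geom_sum₂_mul n
  rw [sub_neg_eq_add, neg_pow, hn, mul_zero, sub_zero] at h
  rw [mul_assoc, h, hpow]

end Ring

/-! ### Elements without nonzero spectrum. -/

section Algebra

variable {A : Type*} [Ring A] [Algebra ℂ A]

/-- The spectrum of `a` contains no nonzero number. -/
def SpectrumSubsetZero (a : A) : Prop :=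
  ∀ z : ℂ, z ≠ 0 → IsUnit (algebraMap ℂ A z - a)

theorem SpectrumSubsetZero.add_isNilpotent {a b : A} (ha : SpectrumSubsetZero a)
    (hb : IsNilpotent b) (hc : Commute a b) : SpectrumSubsetZero (a + b) := by
  intro z hz
  have h : Commute (-b) (algebraMap ℂ A z - a) :=
    ((Algebra.commute_algebraMap_right z b).sub_right hc.symm).neg_left
  have := hb.neg.isUnit_add_left_of_commute (ha z hz) h
  rwa [← sub_eq_add_neg, sub_sub] at this

theorem SpectrumSubsetZero.mul_comm {a b : A} (h : SpectrumSubsetZero (a * b)) :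
    SpectrumSubsetZero (b * a) := by
  intro z hz
  by_contra hu
  have hz' : z ∈ spectrum ℂ (b * a) \ {0} := ⟨hu, hz⟩
  rw [spectrum.nonzero_mul_comm] at hz'
  exact hz'.1 (h z hz)

/-- `z - a * e` acts as `z - a` on `e` and as `z` on `1 - e`, so its inverse is assembled blockwise.
-/
theorem SpectrumSubsetZero.mul_idempotent {a e : A} (ha : SpectrumSubsetZero a)
    (he : e * e = e) (hc : Commute a e) : SpectrumSubsetZero (a * e) := by
  intro z hz
  obtain ⟨u, hu⟩ := ha z hz
  have hce : Commute (u : A) e := by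
    rw [hu]; exact (Algebra.commute_algebraMap_left z e).sub_left hc
  have hr : Commute (↑u⁻¹ : A) e := hce.units_inv_left
  have h1 : algebraMap ℂ A z - a * e = u * e + algebraMap ℂ A z * (1 - e) := by
    rw [hu]; noncomm_ring
  have hzz : algebraMap ℂ A z * algebraMap ℂ A z⁻¹ = 1 := by
    rw [← map_mul, mul_inv_cancel₀ hz, map_one]
  have hzz' : algebraMap ℂ A z⁻¹ * algebraMap ℂ A z = 1 := by
    rw [← map_mul, inv_mul_cancel₀ hz, map_one]
  have hze : Commute (algebraMap ℂ A z) (1 - e) := Algebra.commutes z _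
  have hze' : Commute (algebraMap ℂ A z⁻¹) (1 - e) := Algebra.commutes z⁻¹ _
  have e1 : e * (1 - e) = 0 := by rw [mul_sub, mul_one, he, sub_self]
  have e2 : (1 - e) * e = 0 := by rw [sub_mul, one_mul, he, sub_self]
  have e3 : (1 - e) * (1 - e) = 1 - e := by rw [mul_sub, e2, mul_one, sub_zero]
  have key : ∀ x y x' y' : A, Commute x' e → Commute y' (1 - e) → x * x' = 1 → y * y' = 1 →
      (x * e + y * (1 - e)) * (x' * e + y' * (1 - e)) = 1 := by
    intro x y x' y' hx hy hxx hyy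
    rw [hx.eq, hy.eq]
    have : (x * e + y * (1 - e)) * (e * x' + (1 - e) * y') =
      x * (e * e) * x' + x * (e * (1 - e)) * y' + y * ((1 - e) * e) * x' +
        y * ((1 - e) * (1 - e)) * y' := by noncomm_ring
    rw [this, he, e1, e2, e3, mul_assoc x, ← hx.eq, mul_assoc y (1 - e), ← hy.eq, ← mul_assoc,
      ← mul_assoc, hxx, hyy]
    simp
  rw [h1]
  exact ⟨⟨_, ↑u⁻¹ * e + algebraMap ℂ A z⁻¹ * (1 - e),
    key _ _ _ _ hr hze' (by simp) hzz, key _ _ _ _ hce hze (by simp) hzz'⟩, rfl⟩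

theorem SpectrumSubsetZero.op {a : A} (h : SpectrumSubsetZero a) :
    SpectrumSubsetZero (MulOpposite.op a) := fun z hz => by
  simpa using (h z hz).op

theorem SpectrumSubsetZero.unop {a : Aᵐᵒᵖ} (h : SpectrumSubsetZero a) :
    SpectrumSubsetZero a.unop := fun z hz => by
  simpa using (h z hz).unop

end Algebra

theorem spectrumSubsetZero_iff {R : Type*} [NormedRing R] [NormedAlgebra ℂ R] {b : R} :
    SpectrumSubsetZero b ↔ spectralRadius ℂ b = 0 := by
  simp only [spectralRadius, ENNReal.iSup_eq_zero, SpectrumSubsetZero, spectrum.mem_iff]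
  refine forall_congr' fun z => ?_
  simp only [ENNReal.coe_eq_zero, nnnorm_eq_zero]
  tauto

/-! ### Norm estimates for quasi-nilpotent elements. -/

section Banach

variable {A : Type*} [NormedRing A] [NormedAlgebra ℂ A] [CompleteSpace A]

theorem SpectrumSubsetZero.summable_norm_pow_mul {a : A} (ha : SpectrumSubsetZero a) {c : ℝ}
    (hc : 0 ≤ c) : Summable fun k : ℕ => ‖a ^ k‖ * c ^ k := by
  have h := spectrum.pow_norm_pow_one_div_tendsto_nhds_spectralRadius a
  rw [spectrumSubsetZero_iff.1 ha] at h
  -- By Gelfand's formula `‖a ^ k‖` is eventually below the `k`-th power of this bound, which leaves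
  -- ratio `1 / 2` against `(c + 1) ^ k`. Using `c + 1` covers `c = 0`.
  have hε : (0 : ENNReal) < ENNReal.ofReal (1 / (2 * (c + 1))) := by
    rw [ENNReal.ofReal_pos]; positivity
  have hev := h.eventually (gt_mem_nhds hε)
  refine Summable.of_norm_bounded_eventually_nat (g := fun k => (1 / 2 : ℝ) ^ k)
    summable_geometric_two ?_
  filter_upwards [hev, Filter.eventually_ge_atTop 1] with k hk hk1
  have hk2 : ‖a ^ k‖ ^ (1 / k : ℝ) < 1 / (2 * (c + 1)) :=
    (ENNReal.ofReal_lt_ofReal_iff (by positivity)).1 hk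
  have hk3 : ‖a ^ k‖ ≤ (1 / (2 * (c + 1))) ^ k := by
    have : (‖a ^ k‖ ^ (1 / k : ℝ)) ^ k = ‖a ^ k‖ := by
      rw [one_div]
      exact Real.rpow_inv_natCast_pow (norm_nonneg _) (by omega)
    rw [← this]
    gcongr
  rw [Real.norm_of_nonneg (by positivity)]
  calc ‖a ^ k‖ * c ^ k ≤ (1 / (2 * (c + 1))) ^ k * (c + 1) ^ k := by gcongr; linarith
    _ = (1 / 2) ^ k := by
      rw [← mul_pow]
      congr 1
      field_simp

/-- Iterating the equation gives the series of `b ^ k * (c * l) * l ^ k`, which converges for any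
`l` because powers of `b` decay faster than every geometric sequence. It serves to remove an
off-diagonal block. -/
theorem SpectrumSubsetZero.exists_eq_add_mul_mul {b : A} (hb : SpectrumSubsetZero b) (c l : A) :
    ∃ g, g = c * l + b * g * l := by
  have hs : Summable fun k : ℕ => b ^ k * (c * l) * l ^ k := by
    refine Summable.of_norm_bounded_eventually_nat
      (g := fun k => ‖c * l‖ * (‖b ^ k‖ * ‖l‖ ^ k))
      ((hb.summable_norm_pow_mul (norm_nonneg l)).mul_left _) ?_
    -- The term `k = 0` is skipped because `‖1‖ ≤ 1` is not assumed.
    filter_upwards [Filter.eventually_ge_atTop 1] with k hk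
    calc ‖b ^ k * (c * l) * l ^ k‖ ≤ ‖b ^ k‖ * ‖c * l‖ * ‖l‖ ^ k := by
          refine (norm_mul_le _ _).trans ?_
          gcongr
          · exact norm_mul_le _ _
          · exact norm_pow_le' l hk
      _ = _ := by ring
  refine ⟨∑' k : ℕ, b ^ k * (c * l) * l ^ k, ?_⟩
  conv_lhs => rw [hs.tsum_eq_zero_add]
  rw [← hs.tsum_mul_left, ← (hs.mul_left b).tsum_mul_right]
  simp only [pow_zero, one_mul, mul_one]
  congr 1
  refine tsum_congr fun k => ?_
  rw [pow_succ', pow_succ]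
  simp only [mul_assoc]

/-- Moving powers of `T` across `F` gives `q * F * p = l ^ k * (q * F) * ((T * p) ^ k * p)` for
every `k`, and the decay of `(T * p) ^ k` beats the growth of `l ^ k`. -/
theorem mul_mul_eq_zero_of_commute {T F p q l : A} (hF : Commute T F) (hp : p * p = p)
    (hTp : Commute T p) (hTq : Commute T q) (hqn : SpectrumSubsetZero (T * p))
    (hl : l * T * q = q) : q * F * p = 0 := by
  have h1 : ∀ k : ℕ, l ^ k * T ^ k * q = q := by
    intro k
    induction k with
    | zero => simp
    | succ k ih =>
      calc l ^ (k + 1) * T ^ (k + 1) * q = l ^ k * (l * T * (T ^ k * q)) := by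
            rw [pow_succ, pow_succ']; simp only [mul_assoc]
        _ = l ^ k * (l * T * q) * T ^ k := by rw [(hTq.pow_left k).eq]; simp only [mul_assoc]
        _ = q := by rw [hl, mul_assoc, ← (hTq.pow_left k).eq, ← mul_assoc, ih]
  have h2 : ∀ k : ℕ, q * F * p = l ^ k * (q * F) * ((T * p) ^ k * p) := by
    intro k
    have h3 : (T * p) ^ k * p = T ^ k * p := by
      rw [hTp.mul_pow, mul_assoc, ← pow_succ, (IsIdempotentElem.pow_succ_eq k hp : p ^ (k + 1) = p)]
    rw [h3]
    calc q * F * p = l ^ k * (T ^ k * q) * F * p := by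
          rw [← mul_assoc (l ^ k), h1]
      _ = l ^ k * q * (T ^ k * F) * p := by rw [(hTq.pow_left k).eq]; simp only [mul_assoc]
      _ = _ := by rw [(hF.pow_left k).eq]; simp only [mul_assoc]
  have hlim : Filter.Tendsto (fun k : ℕ => ‖q * F‖ * ‖p‖ * (‖(T * p) ^ k‖ * ‖l‖ ^ k))
      Filter.atTop (nhds 0) := by
    simpa using (hqn.summable_norm_pow_mul (norm_nonneg l)).tendsto_atTop_zero.const_mul
      (‖q * F‖ * ‖p‖)
  refine norm_le_zero_iff.1 (ge_of_tendsto hlim ?_)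
  filter_upwards [Filter.eventually_ge_atTop 1] with k hk
  calc ‖q * F * p‖ = ‖l ^ k * (q * F) * ((T * p) ^ k * p)‖ := by rw [← h2]
    _ ≤ ‖l‖ ^ k * ‖q * F‖ * (‖(T * p) ^ k‖ * ‖p‖) := by
      refine (norm_mul_le _ _).trans ?_
      gcongr
      · refine (norm_mul_le _ _).trans ?_
        gcongr
        exact norm_pow_le' l hk
      · exact norm_mul_le _ _
    _ = _ := by ring

end Banach

end GenDrazin

namespace GenDrazin

/-! ### Splitting off an algebraic summand. -/

section Algebra

variable {A : Type*} [Ring A] [Algebra ℂ A]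

/-- On the range of the idempotent `e`, the element `a` is the direct sum of a left invertible
part, carried by `q`, and of a part without nonzero spectrum, carried by `p`. -/
def IsLeftDrazinOn (a e : A) : Prop :=
  ∃ p q l : A, p + q = e ∧ p * p = p ∧ q * q = q ∧ p * q = 0 ∧ q * p = 0 ∧ Commute a p ∧
    Commute a q ∧ SpectrumSubsetZero (a * p) ∧ l * a * q = q

theorem exists_idempotent_of_isAlgebraic {a : A} (ha : IsAlgebraic ℂ a) :
    ∃ P Q U : Polynomial ℂ, P + Q = 1 ∧ Q = U * Polynomial.X ∧
      Polynomial.aeval a (P * Q) = 0 ∧ IsNilpotent (Polynomial.aeval a (Polynomial.X * P)) := by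
  obtain ⟨f, hf0, hf⟩ := ha
  obtain ⟨g, hfg, hg⟩ := Polynomial.exists_eq_pow_rootMultiplicity_mul_and_not_dvd f hf0 0
  rw [Polynomial.C_0, sub_zero] at hfg hg
  set k := Polynomial.rootMultiplicity 0 f
  -- The exponent is `k + 1` and not `k` so that `Q` is divisible by `X` even when `k = 0`. The
  -- Bézout terms are the spectral idempotent at zero and its complement.
  have hcop : IsCoprime (Polynomial.X ^ (k + 1)) g :=
    (((Polynomial.irreducible_X).coprime_iff_not_dvd).2 hg).pow_left
  obtain ⟨u, v, huv⟩ := hcop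
  have hz : ∀ r : Polynomial ℂ, Polynomial.aeval a (f * r) = 0 := fun r => by
    rw [map_mul, hf, zero_mul]
  refine ⟨v * g, u * Polynomial.X ^ (k + 1), u * Polynomial.X ^ k, by rw [add_comm, huv],
    by ring, ?_, k + 1, ?_⟩
  · rw [show v * g * (u * Polynomial.X ^ (k + 1)) = f * (u * v * Polynomial.X) by
      linear_combination (-(u * v * Polynomial.X)) * hfg]
    exact hz _
  · rw [← map_pow, show (Polynomial.X * (v * g)) ^ (k + 1) =
      f * (Polynomial.X * v ^ (k + 1) * g ^ k) by
      linear_combination (-(Polynomial.X * v ^ (k + 1) * g ^ k)) * hfg]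
    exact hz _

/-- An algebraic element is a nilpotent part plus an invertible part; the first is absorbed into
`p`, the second into `q`. -/
theorem IsLeftDrazinOn.add_of_isAlgebraic {a e d : A} (h : IsLeftDrazinOn a e) (hd : d * d = d)
    (hed : e * d = 0) (hde : d * e = 0) (hc : Commute a d) (ha : IsAlgebraic ℂ (a * d)) :
    IsLeftDrazinOn a (e + d) := by
  obtain ⟨p, q, l, hpq, hp, hq, hpq0, hqp0, hap, haq, hqn, hl⟩ := h
  obtain ⟨P, Q, U, hPQ, hQU, hPQ0, hPn⟩ := exists_idempotent_of_isAlgebraic ha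
  set b := a * d
  have hbd : Commute b d := hc.mul_left (Commute.refl d)
  have hab : Commute a b := (Commute.refl a).mul_right hc
  have had (R : Polynomial ℂ) : Commute (Polynomial.aeval b R) d := by
    induction R using Polynomial.induction_on' with
    | add r s hr hs => rw [map_add]; exact hr.add_left hs
    | monomial n c =>
      rw [Polynomial.aeval_monomial]
      exact (Algebra.commute_algebraMap_left c d).mul_left (hbd.pow_left n)
  have haR (R : Polynomial ℂ) : Commute a (Polynomial.aeval b R) := by
    induction R using Polynomial.induction_on' with
    | add r s hr hs => rw [map_add]; exact hr.add_right hs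
    | monomial n c =>
      rw [Polynomial.aeval_monomial]
      exact (Algebra.commute_algebraMap_right c a).mul_right (hab.pow_right n)
  set r := Polynomial.aeval b P
  set s := Polynomial.aeval b Q
  set t := Polynomial.aeval b U
  have hrs : r + s = 1 := by simp only [r, s, ← map_add, hPQ, map_one]
  have hrs0 : r * s = 0 := by simp only [r, s, ← map_mul, hPQ0]
  have hsr0 : s * r = 0 := by simp only [r, s, ← map_mul, mul_comm Q, hPQ0]
  have hst : s = t * b := by simp only [s, t, hQU, map_mul, Polynomial.aeval_X]
  have hbr : IsNilpotent (b * r) := by simpa only [map_mul, Polynomial.aeval_X] using hPn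
  have hrr : r * r = r := by
    have := congrArg (r * ·) hrs
    simpa [mul_add, hrs0] using this
  have hss : s * s = s := by
    have := congrArg (s * ·) hrs
    simpa [mul_add, hsr0] using this
  have hrd : Commute r d := had P
  have hsd : Commute s d := had Q
  have hpe : p * e = p := by rw [← hpq, mul_add, hp, hpq0, add_zero]
  have hep : e * p = p := by rw [← hpq, add_mul, hp, hqp0, add_zero]
  have hqe : q * e = q := by rw [← hpq, mul_add, hq, hqp0, zero_add]
  have heq : e * q = q := by rw [← hpq, add_mul, hq, hpq0, zero_add]
  have hpd : p * d = 0 := by rw [← hpe, mul_assoc, hed, mul_zero]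
  have hdp : d * p = 0 := by rw [← hep, ← mul_assoc, hde, zero_mul]
  have hqd : q * d = 0 := by rw [← hqe, mul_assoc, hed, mul_zero]
  have hdq : d * q = 0 := by rw [← heq, ← mul_assoc, hde, zero_mul]
  have hprod : ∀ x y : A, Commute y d → x * d * (y * d) = x * y * d := by
    intro x y hy
    rw [hy.eq, mul_assoc x, ← mul_assoc d, hd, ← hy.eq, mul_assoc]
  have hl0 : ∀ x y : A, x * d = 0 → Commute y d → x * (y * d) = 0 := by
    intro x y hx hy
    rw [hy.eq, ← mul_assoc, hx, zero_mul]
  have hr0 : ∀ x y : A, d * x = 0 → y * d * x = 0 := by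
    intro x y hx
    rw [mul_assoc, hx, mul_zero]
  have hard : a * (r * d) = b * r := by rw [hrd.eq, ← mul_assoc]
  -- `b * r` is nilpotent, and `s = t * b` makes `t` an inverse of `b` on `s`; the factors `e` and
  -- `d` keep the two blocks apart.
  refine ⟨p + r * d, q + s * d, l * e + t * d, ?_, ?_, ?_, ?_, ?_, ?_, ?_, ?_, ?_⟩
  · rw [← hpq]
    calc p + r * d + (q + s * d) = p + q + (r + s) * d := by noncomm_ring
      _ = _ := by rw [hrs, one_mul]
  · rw [mul_add, add_mul, add_mul, hp, hr0 _ _ hdp, hl0 _ _ hpd hrd, hprod _ _ hrd, hrr]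
    simp
  · rw [mul_add, add_mul, add_mul, hq, hr0 _ _ hdq, hl0 _ _ hqd hsd, hprod _ _ hsd, hss]
    simp
  · rw [mul_add, add_mul, add_mul, hpq0, hr0 _ _ hdq, hl0 _ _ hpd hsd, hprod _ _ hsd, hrs0]
    simp
  · rw [mul_add, add_mul, add_mul, hqp0, hr0 _ _ hdp, hl0 _ _ hqd hrd, hprod _ _ hrd, hsr0]
    simp
  · exact hap.add_right ((haR P).mul_right hc)
  · exact haq.add_right ((haR Q).mul_right hc)
  · rw [mul_add, hard]
    refine hqn.add_isNilpotent hbr ?_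
    have h1 : a * p * (b * r) = 0 := by
      rw [← hard, haR P |>.mul_right hc |>.eq, mul_assoc a, ← mul_assoc p, hl0 _ _ hpd hrd]
      simp
    have h2 : b * r * (a * p) = 0 := by
      rw [hap.eq, ← hard, ← mul_assoc, mul_assoc a, mul_assoc r, hdp]
      simp
    exact h1.trans h2.symm
  · have h1 : (l * e + t * d) * a * q = q := by
      rw [mul_assoc, haq.eq, ← mul_assoc, add_mul, mul_assoc l, heq, mul_assoc t, hdq, mul_zero,
        add_zero, mul_assoc, ← haq.eq, ← mul_assoc, hl]
    have h2 : (l * e + t * d) * a * (s * d) = s * d := by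
      have h3 : a * (s * d) = d * b * s := by
        rw [hsd.eq, ← mul_assoc]
        change b * s = _
        rw [← hbd.eq]
        change _ = a * d * d * s
        rw [mul_assoc a d d, hd]
      rw [mul_assoc, h3]
      calc (l * e + t * d) * (d * b * s) = l * (e * d) * b * s + t * (d * d) * b * s := by
            noncomm_ring
        _ = t * (b * d) * s := by rw [hed, hd, hbd.eq]; noncomm_ring
        _ = t * b * (d * s) := by noncomm_ring
        _ = s * d := by rw [← hst, ← hsd.eq, ← mul_assoc, hss]
    rw [mul_add, h1, h2]

end Algebra

/-! ### Restriction and nilpotent perturbation in a Banach algebra. -/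

section Banach

variable {A : Type*} [NormedRing A] [NormedAlgebra ℂ A] [CompleteSpace A]

/-- A block triangular element is similar to a block diagonal one. -/
theorem isLeftDrazinOn_of_triangular {S p q m : A} (hp : p * p = p) (hq : q * q = q)
    (hpq : p * q = 0) (hqp : q * p = 0) (hS : Commute S (p + q)) (hqSp : q * S * p = 0)
    (hqn : SpectrumSubsetZero (S * p)) (hm : m * (q * S * q) = q) :
    IsLeftDrazinOn S (p + q) := by
  have hSp : p * S * p = S * p := by
    calc p * S * p = (p + q) * S * p := by rw [add_mul, add_mul, hqSp, add_zero]
      _ = S * ((p + q) * p) := by rw [← hS.eq, mul_assoc]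
      _ = S * p := by rw [add_mul, hp, hqp, add_zero]
  have hqS : q * S * q = q * S := by
    calc q * S * q = q * S * (p + q) := by rw [mul_add, hqSp, zero_add]
      _ = q * (p + q) * S := by rw [mul_assoc, hS.eq, mul_assoc]
      _ = q * S := by rw [mul_add, hq, hqp, zero_add]
  have hpS : p * S = S * p + p * S * q := by
    calc p * S = p * (p + q) * S := by rw [mul_add, hp, hpq, add_zero]
      _ = p * S * (p + q) := by rw [mul_assoc, ← hS.eq, mul_assoc]
      _ = S * p + p * S * q := by rw [mul_add, hSp]
  -- This `g` lies in the `p`-`q` corner and satisfies `g * S = p * S * q + S * g`, which is what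
  -- makes `p - g = (1 + g) * p * (1 - g)` commute with `S`.
  obtain ⟨g, hg⟩ := hqn.exists_eq_add_mul_mul (p * S * q) (q * m * q)
  have hlS : q * m * q * S = q := by
    calc q * m * q * S = q * (m * (q * S)) := by simp only [mul_assoc]
      _ = q := by rw [← hqS, hm, hq]
  have hgq : g * q = g := by
    have hlq : q * m * q * q = q * m * q := by rw [mul_assoc, hq]
    rw [hg, add_mul, mul_assoc (p * S * q), mul_assoc (S * p * g), hlq]
  have hpg : p * g = g := by
    rw [hg, mul_add]
    congr 1
    · simp only [← mul_assoc, hp]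
    · rw [mul_assoc (S * p), ← mul_assoc p (S * p), ← mul_assoc p S p, hSp]
  have hgp : g * p = 0 := by rw [← hgq, mul_assoc, hqp, mul_zero]
  have hqg : q * g = 0 := by rw [← hpg, ← mul_assoc, hqp, zero_mul]
  have hgg : g * g = 0 := by
    calc g * g = g * q * g := by rw [hgq]
      _ = 0 := by rw [mul_assoc, hqg, mul_zero]
  have hgS : g * S = p * S * q + S * g := by
    nth_rw 1 [hg]
    rw [add_mul, mul_assoc (p * S * q), mul_assoc (S * p * g), hlS, mul_assoc (S * p), hgq,
      mul_assoc S, hpg, mul_assoc (p * S), hq]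
  have hc : Commute S (p - g) := by
    change S * (p - g) = (p - g) * S
    rw [mul_sub, sub_mul, hpS, hgS]
    abel
  have hc' : Commute S (q + g) := by
    have := hS.sub_right hc
    rwa [show p + q - (p - g) = q + g by abel] at this
  refine ⟨p - g, q + g, (q + g) * (q * m * q), by abel, ?_, ?_, ?_, ?_, hc, hc', ?_, ?_⟩
  · rw [mul_sub, sub_mul, sub_mul, hp, hpg, hgp, hgg]; simp
  · rw [mul_add, add_mul, add_mul, hq, hqg, hgq, hgg]; simp
  · rw [mul_add, sub_mul, sub_mul, hpq, hgq, hpg, hgg]; simp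
  · rw [mul_sub, add_mul, add_mul, hqp, hgp, hqg, hgg]; simp
  -- `S * (p - g) = S * p * (1 - g)`; swapping the factors keeps the nonzero spectrum, and `g * S *
  -- p = g * p * S * p = 0`.
  · have h1 : SpectrumSubsetZero ((1 - g) * (S * p)) := by
      rwa [sub_mul, one_mul, ← hSp, ← mul_assoc, ← mul_assoc, hgp, zero_mul, zero_mul, sub_zero,
        hSp]
    have h2 := h1.mul_comm
    rwa [mul_sub, mul_one, mul_assoc, hpg, ← mul_sub] at h2
  · rw [mul_assoc, hc'.eq, ← mul_assoc, mul_assoc (q + g)]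
    calc (q + g) * (q * m * q * (q + g)) * S
        = (q + g) * (q * m * q) * ((q + g) * S) := by simp only [mul_assoc]
      _ = (q + g) * (q * m * q * S) * (q + g) := by rw [← hc'.eq]; simp only [mul_assoc]
      _ = (q + g) * (q * (q + g)) := by rw [hlS, mul_assoc]
      _ = q + g := by
        rw [mul_add q, hq, hqg, add_zero, add_mul, hq, hgq]

/-- `e` need not commute with `p` and `q`, but `q * e * p = 0` already makes the compressions `e * p
* e` and `e * q * e` idempotent. -/
theorem IsLeftDrazinOn.restrict {T e : A} (h : IsLeftDrazinOn T 1) (he : e * e = e)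
    (hc : Commute T e) : IsLeftDrazinOn T e := by
  obtain ⟨p, q, l, hpq, hp, hq, hpq0, hqp0, hTp, hTq, hqn, hl⟩ := h
  have h0 : q * e * p = 0 := mul_mul_eq_zero_of_commute hc hp hTp hTq hqn hl
  have hep : p * e * p = e * p := by
    calc p * e * p = (p + q) * e * p := by rw [add_mul, add_mul, h0, add_zero]
      _ = e * p := by rw [hpq, one_mul]
  have hqe : q * e * q = q * e := by
    calc q * e * q = q * e * (p + q) := by rw [mul_add, h0, zero_add]
      _ = q * e := by rw [hpq, mul_one]
  have hpp : (e * p * e) * (e * p * e) = e * p * e := by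
    calc (e * p * e) * (e * p * e) = e * (p * (e * e) * p) * e := by simp only [mul_assoc]
      _ = _ := by rw [he, hep, ← mul_assoc, he]
  have hqq : (e * q * e) * (e * q * e) = e * q * e := by
    calc (e * q * e) * (e * q * e) = e * (q * (e * e) * q) * e := by simp only [mul_assoc]
      _ = _ := by rw [he, hqe, mul_assoc e, mul_assoc q, he, mul_assoc]
  have hsum : e * p * e + e * q * e = e := by
    rw [← add_mul, ← mul_add, hpq, mul_one, he]
  have hq' : e * q * e = e - e * p * e := eq_sub_of_add_eq' hsum
  have hee : e * (e * p * e) = e * p * e := by rw [← mul_assoc, ← mul_assoc, he]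
  have hee' : e * p * e * e = e * p * e := by rw [mul_assoc, he]
  -- The `q` after `l` lets `q * e * q = q * e` absorb the right-hand `q`, leaving `l * (q * T) =
  -- q`.
  refine ⟨e * p * e, e * q * e, e * l * q * e, hsum, hpp, hqq, ?_, ?_, ?_, ?_, ?_, ?_⟩
  · rw [hq', mul_sub, hee', hpp, sub_self]
  · rw [hq', sub_mul, hee, hpp, sub_self]
  · exact (hc.mul_right hTp).mul_right hc
  · exact (hc.mul_right hTq).mul_right hc
  · have h1 : SpectrumSubsetZero (T * p * (e * p)) := by
      refine hqn.mul_idempotent ?_ ?_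
      · rw [mul_assoc, ← mul_assoc p, hep, ← mul_assoc, he]
      · change T * p * (e * p) = e * p * (T * p)
        rw [mul_assoc, ← mul_assoc p, hep, mul_assoc e, ← mul_assoc p, ← hTp.eq, mul_assoc T, hp,
          ← mul_assoc, ← mul_assoc, hc.eq]
    have h2 : e * (T * e * p) = T * p * (e * p) := by
      rw [mul_assoc T p, ← mul_assoc p, hep, ← mul_assoc, ← mul_assoc, ← hc.eq, mul_assoc T, he,
        mul_assoc]
    rw [← h2] at h1
    have := h1.mul_comm
    rwa [mul_assoc, mul_assoc, ← mul_assoc e] at this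
  · calc e * l * q * e * T * (e * q * e) = e * l * (q * (e * T * e) * q) * e := by
          simp only [mul_assoc]
      _ = e * l * (q * e * (T * q)) * e := by
          rw [← hc.eq, mul_assoc T, he, hc.eq]; simp only [mul_assoc]
      _ = e * l * ((q * e * q) * T) * e := by rw [hTq.eq]; simp only [mul_assoc]
      _ = e * l * q * (e * T) * e := by rw [hqe]; simp only [mul_assoc]
      _ = e * (l * (q * T)) * (e * e) := by rw [← hc.eq]; simp only [mul_assoc]
      _ = e * q * e := by rw [he, ← hTq.eq, ← mul_assoc l, hl]

/-- Since `q * F * p = 0`, both diagonal corners of `F` are nilpotent. Each corner of `T` keeps its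
type under the commuting nilpotent, and the triangular result applies. -/
theorem IsLeftDrazinOn.add_isNilpotent {T F e : A} (h : IsLeftDrazinOn T e) (hTF : Commute T F)
    (hFe : Commute F e) (hn : IsNilpotent (F * e)) : IsLeftDrazinOn (T + F) e := by
  obtain ⟨p, q, l, rfl, hp, hq, hpq, hqp, hTp, hTq, hqn, hl⟩ := h
  have h0 : q * F * p = 0 := mul_mul_eq_zero_of_commute hTF hp hTp hTq hqn hl
  have hFp : p * F * p = F * p := by
    calc p * F * p = (p + q) * F * p := by rw [add_mul, add_mul, h0, add_zero]
      _ = F * ((p + q) * p) := by rw [← hFe.eq, mul_assoc]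
      _ = F * p := by rw [add_mul, hp, hqp, add_zero]
  have hqF : q * F * q = q * F := by
    calc q * F * q = q * F * (p + q) := by rw [mul_add, h0, zero_add]
      _ = q * (p + q) * F := by rw [mul_assoc, hFe.eq, mul_assoc]
      _ = q * F := by rw [mul_add, hq, hqp, zero_add]
  have hep : (p + q) * p = p := by rw [add_mul, hp, hqp, add_zero]
  have hqe : q * (p + q) = q := by rw [mul_add, hq, hqp, zero_add]
  have hee : (p + q) * (p + q) = p + q := by
    rw [mul_add, add_mul, add_mul, hp, hqp, hpq, hq]; simp
  obtain ⟨n, hn⟩ := hn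
  have hFn : F ^ n * (p + q) = 0 := by
    rcases n with _ | n
    · rw [pow_zero] at hn ⊢
      rw [hn, zero_mul]
    · rwa [hFe.mul_pow, IsIdempotentElem.pow_succ_eq n hee] at hn
  have hnp : IsNilpotent (F * p) := by
    -- `(F * p) ^ j = F ^ j * p` can fail at `j = 0`, hence `n + 1`.
    refine ⟨n + 1, ?_⟩
    have h1 : ∀ k : ℕ, (F * p) ^ (k + 1) = F ^ (k + 1) * p := by
      intro k
      induction k with
      | zero => simp
      | succ k ih =>
        rw [pow_succ, ih, mul_assoc, ← mul_assoc p, hFp, pow_succ F (k + 1), mul_assoc]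
    rw [h1, ← hep, ← mul_assoc, pow_succ', mul_assoc F, hFn, mul_zero, zero_mul]
  have hnq : IsNilpotent (q * F) := by
    refine ⟨n + 1, ?_⟩
    have h1 : ∀ k : ℕ, (q * F) ^ (k + 1) = q * F ^ (k + 1) := by
      intro k
      induction k with
      | zero => simp
      | succ k ih =>
        rw [pow_succ', ih, ← mul_assoc, hqF, pow_succ' F (k + 1), mul_assoc]
    rw [h1, ← hqe, mul_assoc, ← (hFe.pow_left _).eq, pow_succ', mul_assoc F, hFn, mul_zero,
      mul_zero]
  -- Adding `1 - q` turns left invertibility in the `q` corner into left invertibility in the whole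
  -- algebra.
  obtain ⟨m, hm⟩ := exists_left_inverse_add_of_isNilpotent (l := q * l * q + (1 - q))
    (u := T * q + (1 - q)) (f := q * F)
    (by
      calc (q * l * q + (1 - q)) * (T * q + (1 - q))
          = q * l * (q * (T * q)) + q * l * (q - q * q) + (1 - q) * (T * q) + (1 - q - (q - q * q))
            := by noncomm_ring
        _ = 1 := by
          rw [hTq.eq, ← mul_assoc q q, hq, sub_self, mul_zero, sub_mul, one_mul, ← mul_assoc q q, hq,
            ← hTq.eq, mul_assoc q, ← mul_assoc l, hl, hq]
          abel)
    (by
      change (T * q + (1 - q)) * (q * F) = q * F * (T * q + (1 - q))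
      calc (T * q + (1 - q)) * (q * F) = T * (q * q) * F + (q - q * q) * F := by noncomm_ring
        _ = q * (T * F) := by rw [hq, hTq.eq, sub_self, zero_mul, add_zero, mul_assoc]
        _ = q * F * q * T := by rw [hTF.eq, hqF, mul_assoc]
        _ = q * F * (T * q) + (q * F - q * F * q) := by
          rw [hTq.eq, hqF, sub_self, add_zero, ← mul_assoc, hqF]
        _ = q * F * (T * q + (1 - q)) := by noncomm_ring) hnq
  refine isLeftDrazinOn_of_triangular (m := m) hp hq hpq hqp ?_ ?_ ?_ ?_
  · exact (hTp.add_right hTq).add_left hFe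
  · rw [mul_add, add_mul, h0, ← hTq.eq, mul_assoc, hqp, mul_zero, add_zero]
  · rw [add_mul]
    refine hqn.add_isNilpotent hnp ?_
    change T * p * (F * p) = F * p * (T * p)
    rw [mul_assoc, ← mul_assoc p, hFp, hTp.eq, mul_assoc F, ← mul_assoc p, hp, ← hTp.eq,
      ← mul_assoc, ← mul_assoc, hTF.eq]
  · calc m * (q * (T + F) * q) = m * (q * T * q + q * F * q) := by noncomm_ring
      _ = m * (T * q * q + (q - q * q) + q * F * q) := by rw [← hTq.eq, hq, sub_self, add_zero]
      _ = m * (T * q + (1 - q) + q * F) * q := by noncomm_ring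
      _ = q := by rw [hm, one_mul]

theorem IsLeftDrazinOn.add_of_idempotent {T F e : A} (h : IsLeftDrazinOn T 1) (hTF : Commute T F)
    (he : e * e = e) (hTe : Commute T e) (hFe : Commute F e) (hn : IsNilpotent (F * e))
    (ha : IsAlgebraic ℂ ((T + F) * (1 - e))) : IsLeftDrazinOn (T + F) 1 := by
  have h1 := ((h.restrict he hTe).add_isNilpotent hTF hFe hn).add_of_isAlgebraic (d := 1 - e)
    (by rw [mul_sub, sub_mul, sub_mul, he]; simp) (by rw [mul_sub, he]; simp)
    (by rw [sub_mul, he]; simp)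
    ((Commute.one_right _).sub_right (hTe.add_left hFe)) ha
  simpa using h1

end Banach

end GenDrazin

namespace GenDrazin

/-! ### Operators with a power of finite rank. -/

section Operators

variable {E G : Type*} [NormedAddCommGroup E] [NormedSpace ℂ E] [NormedAddCommGroup G]
  [NormedSpace ℂ G]

/-- Jacobson's identity: the inverse of `z - v u` is `z⁻¹ (1 + v (z - u v)⁻¹ u)`. Having two spaces
allows passage between a subspace and `X`. -/
theorem SpectrumSubsetZero.comp_comm {u : E →L[ℂ] G} {v : G →L[ℂ] E}
    (h : SpectrumSubsetZero (u ∘L v)) : SpectrumSubsetZero (v ∘L u) := by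
  intro z hz
  obtain ⟨w, hw⟩ := h z hz
  have hw1 : ∀ x, z • (↑w⁻¹ : G →L[ℂ] G) x - u (v ((↑w⁻¹ : G →L[ℂ] G) x)) = x := by
    intro x
    have := congrArg (fun f : G →L[ℂ] G => f x) (w.mul_inv)
    rw [hw] at this
    simpa [Algebra.algebraMap_eq_smul_one] using this
  have hw2 : ∀ x, (↑w⁻¹ : G →L[ℂ] G) (z • x - u (v x)) = x := by
    intro x
    have := congrArg (fun f : G →L[ℂ] G => f x) (w.inv_mul)
    rw [hw] at this
    simpa [Algebra.algebraMap_eq_smul_one] using this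
  refine ⟨⟨algebraMap ℂ _ z - v ∘L u, z⁻¹ • (1 + v ∘L (↑w⁻¹ : G →L[ℂ] G) ∘L u), ?_, ?_⟩, rfl⟩
  · ext x
    have h1 := congrArg v (hw1 (u x))
    simp only [map_sub, map_smul] at h1
    have h2 : z • x + z • v ((↑w⁻¹ : G →L[ℂ] G) (u x)) - (v (u x) +
        v (u (v ((↑w⁻¹ : G →L[ℂ] G) (u x))))) = z • x := by
      rw [← sub_eq_zero]
      rw [← sub_eq_zero] at h1
      rw [← h1]
      abel
    have h3 : z⁻¹ • (z • x + z • v ((↑w⁻¹ : G →L[ℂ] G) (u x)) - (v (u x) +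
        v (u (v ((↑w⁻¹ : G →L[ℂ] G) (u x)))))) = x := by
      rw [h2, inv_smul_smul₀ hz]
    have : ((algebraMap ℂ (E →L[ℂ] E) z - v ∘L u) *
        (z⁻¹ • (1 + v ∘L (↑w⁻¹ : G →L[ℂ] G) ∘L u))) x = z⁻¹ • (z • x +
        z • v ((↑w⁻¹ : G →L[ℂ] G) (u x)) - (v (u x) +
        v (u (v ((↑w⁻¹ : G →L[ℂ] G) (u x)))))) := by
      simp [Algebra.algebraMap_eq_smul_one, smul_sub, smul_comm z z⁻¹]
    rw [this, h3]
    rfl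
  · ext x
    have h1 := congrArg v (hw2 (u x))
    have : (z⁻¹ • (1 + v ∘L (↑w⁻¹ : G →L[ℂ] G) ∘L u) *
        (algebraMap ℂ (E →L[ℂ] E) z - v ∘L u)) x = z⁻¹ • (z • x - v (u x) +
        v ((↑w⁻¹ : G →L[ℂ] G) (z • u x - u (v (u x))))) := by
      simp [Algebra.algebraMap_eq_smul_one]
    rw [this, h1, sub_add_cancel, inv_smul_smul₀ hz]
    rfl

end Operators

theorem isAlgebraic_of_finiteDimensional_range {X : Type*} [NormedAddCommGroup X]
    [NormedSpace ℂ X] (G : X →L[ℂ] X) (h : FiniteDimensional ℂ G.range) : IsAlgebraic ℂ G := by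
  set r : Module.End ℂ G.range :=
    G.toLinearMap.restrict (p := G.range) (q := G.range) fun x _ => ⟨x, rfl⟩
  have hr : ∀ (p : Polynomial ℂ) (x : G.range),
      ((Polynomial.aeval r p x : G.range) : X) = Polynomial.aeval G p (x : X) := by
    intro p x
    induction p using Polynomial.induction_on' with
    | add p q hp hq => simp [hp, hq]
    | monomial n c =>
      simp only [Polynomial.aeval_monomial, Algebra.algebraMap_eq_smul_one, smul_mul_assoc, one_mul,
        LinearMap.smul_apply, smul_apply, Submodule.coe_smul]
      congr 1
      induction n generalizing x with
      | zero => simp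
      | succ n ih => rw [pow_succ, pow_succ, Module.End.mul_apply, ih]; rfl
  -- The factor `X` maps into the range, where Cayley–Hamilton applies.
  refine ⟨LinearMap.charpoly r * Polynomial.X,
    mul_ne_zero (LinearMap.charpoly_monic r).ne_zero Polynomial.X_ne_zero, ?_⟩
  ext x
  rw [map_mul, Polynomial.aeval_X]
  change Polynomial.aeval G (LinearMap.charpoly r) (G x) = 0
  rw [← hr (LinearMap.charpoly r) ⟨G x, x, rfl⟩, LinearMap.aeval_self_charpoly]
  rfl

theorem isAlgebraic_op {R A : Type*} [CommRing R] [Ring A] [Algebra R A] {a : A}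
    (h : IsAlgebraic R a) : IsAlgebraic R (MulOpposite.op a) := by
  obtain ⟨f, hf0, hf⟩ := h
  refine ⟨f, hf0, ?_⟩
  have : ∀ g : Polynomial R,
      Polynomial.aeval (MulOpposite.op a) g = MulOpposite.op (Polynomial.aeval a g) := by
    intro g
    induction g using Polynomial.induction_on' with
    | add r s hr hs => rw [map_add, map_add, hr, hs, MulOpposite.op_add]
    | monomial n c =>
      rw [Polynomial.aeval_monomial, Polynomial.aeval_monomial, MulOpposite.op_mul,
        MulOpposite.op_pow, ← MulOpposite.algebraMap_apply, Algebra.commutes]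
  rw [this, hf, MulOpposite.op_zero]

section Normed

variable {X : Type*} [NormedAddCommGroup X] [NormedSpace ℂ X] {T F : X →L[ℂ] X}
  {X₁ X₂ : Submodule ℂ X}

theorem Reduces.symm (h : Reduces T X₁ X₂) : Reduces T X₂ X₁ :=
  ⟨h.isClosed_right, h.isClosed_left, h.isCompl.symm, h.right_invariant, h.left_invariant⟩

theorem Reduces.ext_mem (h : Reduces T X₁ X₂) {U V : X →L[ℂ] X} (h₁ : ∀ x ∈ X₁, U x = V x)
    (h₂ : ∀ x ∈ X₂, U x = V x) : U = V := by
  ext x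
  obtain ⟨y, hy, z, hz, rfl⟩ := Submodule.mem_sup.1
    (h.isCompl.sup_eq_top ▸ Submodule.mem_top : x ∈ X₁ ⊔ X₂)
  rw [map_add, map_add, h₁ y hy, h₂ z hz]

theorem isAlgebraic_add_mul_one_sub {e : X →L[ℂ] X} (he : Commute T e) (hFe : Commute F e)
    (hf : FiniteDimensional ℂ (1 - e).range) : IsAlgebraic ℂ ((T + F) * (1 - e)) := by
  refine isAlgebraic_of_finiteDimensional_range _ ?_
  rw [((Commute.one_right (T + F)).sub_right (he.add_left hFe)).eq]
  exact Submodule.finiteDimensional_of_le (S₂ := (1 - e).range) (by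
    rintro _ ⟨x, rfl⟩
    exact ⟨(T + F) x, rfl⟩)

/-- The spectral idempotent at zero of an operator with a power of finite rank. -/
theorem exists_idempotent_of_finiteDimensional_range_pow {F : X →L[ℂ] X}
    (hF : ∃ n : ℕ, FiniteDimensional ℂ (F ^ n).range) :
    ∃ e : X →L[ℂ] X, e * e = e ∧ (∀ S, Commute S F → Commute S e) ∧ IsNilpotent (F * e) ∧
      FiniteDimensional ℂ (1 - e).range := by
  obtain ⟨n, hn⟩ := hF
  have hfin : ∀ (U V : X →L[ℂ] X), FiniteDimensional ℂ U.range →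
      FiniteDimensional ℂ (U * V).range := fun U V hU =>
    Submodule.finiteDimensional_of_le (S₂ := U.range) (by
      rintro _ ⟨x, rfl⟩
      exact ⟨V x, rfl⟩)
  have hn1 : FiniteDimensional ℂ (F ^ (n + 1)).range := by
    rw [pow_succ]
    exact hfin _ _ hn
  have halg : IsAlgebraic ℂ F := by
    obtain ⟨f, hf0, hf⟩ := isAlgebraic_of_finiteDimensional_range _ hn1
    refine ⟨Polynomial.expand ℂ (n + 1) f, ?_, ?_⟩
    · rwa [Ne, Polynomial.expand_eq_zero (Nat.succ_pos n)]
    · rwa [Polynomial.expand_aeval]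
  obtain ⟨P, Q, U, hPQ, hQU, hPQ0, hPn⟩ := exists_idempotent_of_isAlgebraic halg
  have hc (S : X →L[ℂ] X) (hS : Commute S F) (R : Polynomial ℂ) :
      Commute S (Polynomial.aeval F R) := by
    induction R using Polynomial.induction_on' with
    | add r s hr hs => rw [map_add]; exact hr.add_right hs
    | monomial n c =>
      rw [Polynomial.aeval_monomial]
      exact (Algebra.commute_algebraMap_right c S).mul_right (hS.pow_right n)
  have hsum : Polynomial.aeval F P + Polynomial.aeval F Q = 1 := by
    rw [← map_add, hPQ, map_one]
  have hP : 1 - Polynomial.aeval F P = Polynomial.aeval F Q := by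
    rw [← hsum, add_sub_cancel_left]
  have hidem : Polynomial.aeval F P * Polynomial.aeval F P = Polynomial.aeval F P := by
    have := congrArg (Polynomial.aeval F P * ·) hsum
    simp only [mul_add, ← map_mul, hPQ0, mul_one, add_zero] at this
    rw [← map_mul, this]
  refine ⟨Polynomial.aeval F P, hidem, fun S hS => hc S hS P, ?_, ?_⟩
  · simpa only [map_mul, Polynomial.aeval_X] using hPn
  · have hQQ : IsIdempotentElem (Polynomial.aeval F Q) := by
      rw [← hP]
      exact IsIdempotentElem.one_sub hidem
    -- Being idempotent, `Q(F)` equals its own power and so factors through `F ^ (n + 1)`, which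
    -- gives finite rank.
    have hpow : Polynomial.aeval F Q = F ^ (n + 1) * Polynomial.aeval F U ^ (n + 1) := by
      rw [← hQQ.pow_succ_eq n, hQU, map_mul, Polynomial.aeval_X,
        (hc F (Commute.refl F) U).symm.mul_pow, ((hc F (Commute.refl F) U).pow_pow _ _).eq]
    rw [hP, hpow]
    exact hfin _ _ hn1

/-- Stability in one direction suffices, since `T` is the perturbation of `T + F` by `-F`. -/
theorem setOf_not_sub_smul_id_eq {P : (X →L[ℂ] X) → Prop} (hTF : Commute T F)
    (hF : ∃ n : ℕ, FiniteDimensional ℂ (F ^ n).range)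
    (hP : ∀ S G : X →L[ℂ] X, P S → Commute S G →
      (∃ n : ℕ, FiniteDimensional ℂ (G ^ n).range) → P (S + G)) :
    {z : ℂ | ¬ P (T - z • ContinuousLinearMap.id ℂ X)} =
      {z : ℂ | ¬ P (T + F - z • ContinuousLinearMap.id ℂ X)} := by
  ext z
  have hz : Commute (T - z • ContinuousLinearMap.id ℂ X) F :=
    hTF.sub_left ((Commute.one_left F).smul_left z)
  have hz' : Commute (T + F - z • ContinuousLinearMap.id ℂ X) (-F) := by
    rw [add_sub_right_comm]
    exact (hz.add_left (Commute.refl F)).neg_right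
  have hF' : ∃ n : ℕ, FiniteDimensional ℂ ((-F) ^ n).range := by
    obtain ⟨n, hn⟩ := hF
    refine ⟨n, Submodule.finiteDimensional_of_le (S₂ := (F ^ n).range) ?_⟩
    rcases Nat.even_or_odd n with h | h
    · rw [h.neg_pow]
    · rw [h.neg_pow]
      rintro _ ⟨x, rfl⟩
      exact ⟨-x, by simp⟩
  refine not_congr ⟨fun h => ?_, fun h => ?_⟩
  · have := hP _ _ h hz hF
    rwa [← add_sub_right_comm] at this
  · have := hP _ _ h hz' hF'
    rwa [add_sub_right_comm, add_neg_cancel_right] at this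

end Normed

/-! ### Reducing subspaces as commuting idempotents. -/

section Banach

variable {X : Type*} [NormedAddCommGroup X] [NormedSpace ℂ X] [CompleteSpace X]
  {T F : X →L[ℂ] X} {X₁ X₂ : Submodule ℂ X}

/-- The bounded projection onto `X₁` along `X₂`. -/
noncomputable def Reduces.toRange (h : Reduces T X₁ X₂) : X →L[ℂ] X₁ :=
  X₁.projectionOntoL X₂ (Submodule.isTopCompl_iff_isCompl_isClosed.2
    ⟨h.isCompl, h.isClosed_left, h.isClosed_right⟩)

/-- The bounded projection onto `X₁` along `X₂`, as an operator on `X`. -/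
noncomputable def Reduces.proj (h : Reduces T X₁ X₂) : X →L[ℂ] X :=
  X₁.subtypeL ∘L h.toRange

theorem Reduces.toRange_coe (h : Reduces T X₁ X₂) (x : X₁) : h.toRange x = x :=
  Submodule.projectionOnto_apply_left h.isCompl x

theorem Reduces.proj_of_mem_left (h : Reduces T X₁ X₂) {x : X} (hx : x ∈ X₁) : h.proj x = x :=
  congrArg Subtype.val (h.toRange_coe ⟨x, hx⟩)

theorem Reduces.proj_of_mem_right (h : Reduces T X₁ X₂) {x : X} (hx : x ∈ X₂) : h.proj x = 0 :=
  congrArg Subtype.val (Submodule.projectionOnto_apply_right h.isCompl ⟨x, hx⟩)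

theorem Reduces.proj_mem (h : Reduces T X₁ X₂) (x : X) : h.proj x ∈ X₁ := (h.toRange x).2

theorem Reduces.proj_mul_self (h : Reduces T X₁ X₂) : h.proj * h.proj = h.proj := by
  ext x
  exact h.proj_of_mem_left (h.proj_mem x)

theorem Reduces.proj_mul_symm_proj (h : Reduces T X₁ X₂) : h.proj * h.symm.proj = 0 := by
  ext x
  exact h.proj_of_mem_right (h.symm.proj_mem x)

theorem Reduces.proj_add_symm_proj (h : Reduces T X₁ X₂) : h.proj + h.symm.proj = 1 := by
  refine h.ext_mem (fun x hx => ?_) fun x hx => ?_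
  · simp [h.proj_of_mem_left hx, h.symm.proj_of_mem_right hx]
  · simp [h.proj_of_mem_right hx, h.symm.proj_of_mem_left hx]

theorem Reduces.commute_proj (h : Reduces T X₁ X₂) : Commute T h.proj := by
  refine h.ext_mem (fun x hx => ?_) fun x hx => ?_
  · simp [h.proj_of_mem_left hx, h.proj_of_mem_left (h.left_invariant x hx)]
  · simp [h.proj_of_mem_right hx, h.proj_of_mem_right (h.right_invariant x hx)]

/-- The restriction and `T * h.proj` are products of the same two maps between `X` and `X₁`, in
opposite orders. -/
theorem Reduces.isQuasiNilpotent_restrict_iff (h : Reduces T X₁ X₂) :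
    IsQuasiNilpotent (T.restrict h.left_invariant) ↔ SpectrumSubsetZero (T * h.proj) := by
  have h1 : T * h.proj = (X₁.subtypeL ∘L T.restrict h.left_invariant) ∘L h.toRange := rfl
  have h2 : T.restrict h.left_invariant =
      h.toRange ∘L (X₁.subtypeL ∘L T.restrict h.left_invariant) := by
    ext x
    exact congrArg Subtype.val (h.toRange_coe (T.restrict h.left_invariant x)).symm
  rw [IsQuasiNilpotent, ← spectrumSubsetZero_iff, h1]
  constructor
  · intro hq
    rw [h2] at hq
    exact hq.comp_comm
  · intro hq
    rw [h2]
    exact hq.comp_comm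

theorem Reduces.hasLeftInverse_restrict_iff (h : Reduces T X₁ X₂) :
    (T.restrict h.left_invariant).HasLeftInverse ↔ ∃ l, l * T * h.proj = h.proj := by
  constructor
  · rintro ⟨g, hg⟩
    refine ⟨X₁.subtypeL ∘L g ∘L h.toRange, ?_⟩
    ext x
    have h1 : h.toRange (T (h.proj x)) = T.restrict h.left_invariant (h.toRange x) :=
      h.toRange_coe (T.restrict h.left_invariant (h.toRange x))
    change ((g (h.toRange (T (h.proj x))) : X₁) : X) = h.proj x
    rw [h1, hg]
    rfl
  · rintro ⟨l, hl⟩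
    refine ⟨h.toRange ∘L l ∘L X₁.subtypeL, fun x => ?_⟩
    have h1 : l (T x) = x := by
      have := congrArg (fun f : X →L[ℂ] X => f x) hl
      simpa [h.proj_of_mem_left x.2] using this
    change h.toRange (l (T x)) = x
    rw [h1, h.toRange_coe]

theorem Reduces.hasRightInverse_restrict_iff (h : Reduces T X₁ X₂) :
    (T.restrict h.left_invariant).HasRightInverse ↔ ∃ r, h.proj * T * r = h.proj := by
  constructor
  · rintro ⟨g, hg⟩
    refine ⟨X₁.subtypeL ∘L g ∘L h.toRange, ?_⟩
    ext x
    change h.proj (T (g (h.toRange x))) = h.proj x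
    rw [h.proj_of_mem_left (h.left_invariant _ (g (h.toRange x)).2)]
    exact congrArg Subtype.val (hg (h.toRange x))
  · rintro ⟨r, hr⟩
    refine ⟨h.toRange ∘L r ∘L X₁.subtypeL, fun x => Subtype.ext ?_⟩
    change T (h.proj (r x)) = x
    have h1 : T (h.proj (r x)) = h.proj (T (r x)) :=
      congrArg (fun f : X →L[ℂ] X => f (r x)) h.commute_proj.eq
    have h2 : h.proj (T (r x)) = h.proj x := congrArg (fun f : X →L[ℂ] X => f x) hr
    rw [h1, h2, h.proj_of_mem_left x.2]

/-- Complementary idempotents commuting with `T` reduce `T`. -/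
theorem exists_reduces_of_idempotent {p q : X →L[ℂ] X} (hpq : p + q = 1) (hp : p * p = p)
    (hq : q * q = q) (hpq0 : p * q = 0) (hqp0 : q * p = 0) (hTp : Commute T p)
    (hTq : Commute T q) :
    ∃ (X₁ X₂ : Submodule ℂ X) (h : Reduces T X₁ X₂), h.proj = q ∧ h.symm.proj = p := by
  have hp' : ∀ x, p (p x) = p x := fun x => congrArg (fun f : X →L[ℂ] X => f x) hp
  have hq' : ∀ x, q (q x) = q x := fun x => congrArg (fun f : X →L[ℂ] X => f x) hq
  have hpq' : ∀ x, p (q x) = 0 := fun x => congrArg (fun f : X →L[ℂ] X => f x) hpq0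
  have hqp' : ∀ x, q (p x) = 0 := fun x => congrArg (fun f : X →L[ℂ] X => f x) hqp0
  have hs : ∀ x, p x + q x = x := fun x => congrArg (fun f : X →L[ℂ] X => f x) hpq
  have hTp' : ∀ x, T (p x) = p (T x) := fun x => congrArg (fun f : X →L[ℂ] X => f x) hTp.eq
  have hTq' : ∀ x, T (q x) = q (T x) := fun x => congrArg (fun f : X →L[ℂ] X => f x) hTq.eq
  -- `p.ker` is the range of `q`; written as a kernel it is visibly closed.
  have h : Reduces T p.ker q.ker := by
    refine ⟨p.isClosed_ker, q.isClosed_ker, ?_, fun x hx => ?_, fun x hx => ?_⟩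
    · rw [isCompl_iff, Submodule.disjoint_def, codisjoint_iff, Submodule.eq_top_iff']
      refine ⟨fun x hx hx' => ?_, fun x => ?_⟩
      · have h1 : p x = 0 := hx
        have h2 : q x = 0 := hx'
        rw [← hs x, h1, h2, add_zero]
      · exact Submodule.mem_sup.2 ⟨q x, hpq' x, p x, hqp' x, by rw [add_comm, hs]⟩
    · have h1 : p x = 0 := hx
      change p (T x) = 0
      rw [← hTp', h1, map_zero]
    · have h1 : q x = 0 := hx
      change q (T x) = 0
      rw [← hTq', h1, map_zero]
  refine ⟨_, _, h, ?_, ?_⟩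
  · refine h.ext_mem (fun x hx => ?_) fun x hx => ?_
    · have h1 : p x = 0 := hx
      have := hs x
      rw [h1, zero_add] at this
      rw [h.proj_of_mem_left hx, this]
    · exact (h.proj_of_mem_right hx).trans (Eq.symm hx)
  · refine h.ext_mem (fun x hx => ?_) fun x hx => ?_
    · exact (h.symm.proj_of_mem_right hx).trans (Eq.symm hx)
    · have h1 : q x = 0 := hx
      have := hs x
      rw [h1, add_zero] at this
      rw [h.symm.proj_of_mem_left hx, this]

theorem isLeftGenDrazin_iff : IsLeftGenDrazin T ↔ IsLeftDrazinOn T 1 := by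
  constructor
  · rintro ⟨X₁, X₂, h, hl, hn⟩
    obtain ⟨l, hl⟩ := h.hasLeftInverse_restrict_iff.1 hl
    exact ⟨h.symm.proj, h.proj, l, h.symm.proj_add_symm_proj, h.symm.proj_mul_self,
      h.proj_mul_self, h.symm.proj_mul_symm_proj, h.proj_mul_symm_proj, h.symm.commute_proj,
      h.commute_proj, h.symm.isQuasiNilpotent_restrict_iff.1 hn, hl⟩
  · rintro ⟨p, q, l, hpq, hp, hq, hpq0, hqp0, hTp, hTq, hn, hl⟩
    obtain ⟨X₁, X₂, h, rfl, rfl⟩ := exists_reduces_of_idempotent hpq hp hq hpq0 hqp0 hTp hTq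
    exact ⟨X₁, X₂, h, h.hasLeftInverse_restrict_iff.2 ⟨l, hl⟩,
      h.symm.isQuasiNilpotent_restrict_iff.2 hn⟩

theorem isRightGenDrazin_iff : IsRightGenDrazin T ↔ IsLeftDrazinOn (MulOpposite.op T) 1 := by
  constructor
  · rintro ⟨X₁, X₂, h, hr, hn⟩
    obtain ⟨r, hr⟩ := h.hasRightInverse_restrict_iff.1 hr
    refine ⟨.op h.symm.proj, .op h.proj, .op r, ?_, ?_, ?_, ?_, ?_, h.symm.commute_proj.op,
      h.commute_proj.op, ?_, ?_⟩
    · rw [← MulOpposite.op_add, h.symm.proj_add_symm_proj, MulOpposite.op_one]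
    · rw [← MulOpposite.op_mul, h.symm.proj_mul_self]
    · rw [← MulOpposite.op_mul, h.proj_mul_self]
    · rw [← MulOpposite.op_mul, h.proj_mul_symm_proj, MulOpposite.op_zero]
    · rw [← MulOpposite.op_mul, h.symm.proj_mul_symm_proj, MulOpposite.op_zero]
    · rw [← MulOpposite.op_mul, ← h.symm.commute_proj.eq]
      exact (h.symm.isQuasiNilpotent_restrict_iff.1 hn).op
    · rw [← MulOpposite.op_mul, ← MulOpposite.op_mul, ← mul_assoc, hr]
  · rintro ⟨p, q, r, hpq, hp, hq, hpq0, hqp0, hTp, hTq, hn, hr⟩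
    obtain ⟨X₁, X₂, h, h1, h2⟩ := exists_reduces_of_idempotent (T := T)
      (p := p.unop) (q := q.unop) (congrArg MulOpposite.unop hpq) (congrArg MulOpposite.unop hp)
      (congrArg MulOpposite.unop hq) (congrArg MulOpposite.unop hqp0)
      (congrArg MulOpposite.unop hpq0) hTp.unop hTq.unop
    refine ⟨X₁, X₂, h, h.hasRightInverse_restrict_iff.2 ⟨r.unop, ?_⟩,
      h.symm.isQuasiNilpotent_restrict_iff.2 ?_⟩
    · rw [h1, mul_assoc]
      exact congrArg MulOpposite.unop hr
    · rw [h2]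
      have := hn.unop
      rwa [hTp.eq] at this

/-- The left and right decompositions must coincide. The vanishing lemma with `F = 1` gives `q * p'
= 0`, and in the opposite algebra `p * q' = 0`, so `q' = q * q' = q`. One-sided inverses on the same
subspace then agree. -/
theorem isGenDrazin_iff : IsGenDrazin T ↔ IsLeftGenDrazin T ∧ IsRightGenDrazin T := by
  constructor
  · rintro ⟨X₁, X₂, h, ⟨u, hu⟩, hn⟩
    refine ⟨⟨X₁, X₂, h, ⟨↑u⁻¹, fun x => ?_⟩, hn⟩, ⟨X₁, X₂, h, ⟨↑u⁻¹, fun x => ?_⟩, hn⟩⟩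
    · rw [← hu]
      exact congrArg (fun f : X₁ →L[ℂ] X₁ => f x) u.inv_mul
    · rw [← hu]
      exact congrArg (fun f : X₁ →L[ℂ] X₁ => f x) u.mul_inv
  · rintro ⟨⟨X₁, X₂, h, hl, hn⟩, ⟨Y₁, Y₂, h', hr, hn'⟩⟩
    obtain ⟨l, hl'⟩ := h.hasLeftInverse_restrict_iff.1 hl
    obtain ⟨r, hr'⟩ := h'.hasRightInverse_restrict_iff.1 hr
    have hz : h.proj * h'.symm.proj = 0 := by
      have := mul_mul_eq_zero_of_commute (Commute.one_right T) h'.symm.proj_mul_self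
        h'.symm.commute_proj h.commute_proj (h'.symm.isQuasiNilpotent_restrict_iff.1 hn') hl'
      rwa [mul_one] at this
    have hz' : h.symm.proj * h'.proj = 0 := by
      have hn1 : SpectrumSubsetZero (MulOpposite.op T * MulOpposite.op h.symm.proj) := by
        rw [← MulOpposite.op_mul, ← h.symm.commute_proj.eq]
        exact (h.symm.isQuasiNilpotent_restrict_iff.1 hn).op
      have := mul_mul_eq_zero_of_commute (Commute.one_right (MulOpposite.op T))
        (congrArg MulOpposite.op h.symm.proj_mul_self)
        h.symm.commute_proj.op h'.commute_proj.op hn1 (l := MulOpposite.op r)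
        (by rw [← MulOpposite.op_mul, ← MulOpposite.op_mul, ← mul_assoc, hr'])
      rw [mul_one] at this
      exact congrArg MulOpposite.unop this
    have heq : h'.proj = h.proj := by
      calc h'.proj = (h.proj + h.symm.proj) * h'.proj := by rw [h.proj_add_symm_proj, one_mul]
        _ = h.proj * (h'.proj + h'.symm.proj) := by rw [add_mul, hz', mul_add, hz]
        _ = h.proj := by rw [h'.proj_add_symm_proj, mul_one]
    rw [heq] at hr'
    obtain ⟨g, hg⟩ := hl
    obtain ⟨g', hg'⟩ := h.hasRightInverse_restrict_iff.2 ⟨r, hr'⟩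
    refine ⟨X₁, X₂, h, ?_, hn⟩
    have e1 : g * T.restrict h.left_invariant = 1 := ContinuousLinearMap.ext hg
    have e2 : T.restrict h.left_invariant * g' = 1 := ContinuousLinearMap.ext hg'
    exact ⟨⟨_, g', e2, by rw [← left_inv_eq_right_inv e1 e2, e1]⟩, rfl⟩

theorem IsLeftGenDrazin.add (h : IsLeftGenDrazin T) (hTF : Commute T F)
    (hF : ∃ n : ℕ, FiniteDimensional ℂ (F ^ n).range) : IsLeftGenDrazin (T + F) := by
  obtain ⟨e, he, hc, hn, hf⟩ := exists_idempotent_of_finiteDimensional_range_pow hF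
  rw [isLeftGenDrazin_iff] at h ⊢
  exact h.add_of_idempotent hTF he (hc T hTF) (hc F (Commute.refl F)) hn
    (isAlgebraic_add_mul_one_sub (hc T hTF) (hc F (Commute.refl F)) hf)

theorem IsRightGenDrazin.add (h : IsRightGenDrazin T) (hTF : Commute T F)
    (hF : ∃ n : ℕ, FiniteDimensional ℂ (F ^ n).range) : IsRightGenDrazin (T + F) := by
  obtain ⟨e, he, hc, hn, hf⟩ := exists_idempotent_of_finiteDimensional_range_pow hF
  rw [isRightGenDrazin_iff] at h ⊢
  have hTe := hc T hTF
  have hFe := hc F (Commute.refl F)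
  rw [MulOpposite.op_add]
  refine h.add_of_idempotent hTF.op (congrArg MulOpposite.op he) hTe.op hFe.op ?_ ?_
  · rw [← MulOpposite.op_mul, ← hFe.eq]
    obtain ⟨n, hn⟩ := hn
    exact ⟨n, by rw [← MulOpposite.op_pow, hn, MulOpposite.op_zero]⟩
  · have h1 := isAlgebraic_op (isAlgebraic_add_mul_one_sub hTe hFe hf)
    rwa [((Commute.one_right (T + F)).sub_right (hTe.add_left hFe)).eq, MulOpposite.op_mul] at h1

theorem IsGenDrazin.add (h : IsGenDrazin T) (hTF : Commute T F)
    (hF : ∃ n : ℕ, FiniteDimensional ℂ (F ^ n).range) : IsGenDrazin (T + F) := by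
  rw [isGenDrazin_iff] at h ⊢
  exact ⟨h.1.add hTF hF, h.2.add hTF hF⟩

end Banach

end GenDrazin

theorem mainTheorem4 {X : Type*} [NormedAddCommGroup X] [NormedSpace ℂ X] [CompleteSpace X]
    (T F : X →L[ℂ] X) (hTF : Commute T F)
    (hF : ∃ n : ℕ, FiniteDimensional ℂ (F ^ n).range) :
    GenDrazin.leftGenDrazinSpectrum T = GenDrazin.leftGenDrazinSpectrum (T + F) ∧
      GenDrazin.rightGenDrazinSpectrum T = GenDrazin.rightGenDrazinSpectrum (T + F) ∧
      GenDrazin.genDrazinSpectrum T = GenDrazin.genDrazinSpectrum (T + F) :=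
  ⟨GenDrazin.setOf_not_sub_smul_id_eq hTF hF fun _ _ h => h.add,
    GenDrazin.setOf_not_sub_smul_id_eq hTF hF fun _ _ h => h.add,
    GenDrazin.setOf_not_sub_smul_id_eq hTF hF fun _ _ h => h.add⟩
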